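/- An infinite frieze (of positive integers) is an array $(m_{ij})_{i,j\in\mathbb Z,\ j\ge i-2}$ of integers with $m_{i,i-2}=0$, $m_{i,i-1}=1$, $m_{ij}>0$ for $i\le j$, and $m_{ij}m_{i+1,j+1}-m_{i+1,j}m_{i,j+1}=1$ for all $j\ge i-1$. It has period $n\ge 1$ if its quiddity row $a_i:=m_{ii}$ satisfies $a_{i+n}=a_i$ for all $i$. For $n\ge 1$, $m\ge 0$ let $A_{n,m}$ be the annulus with marked points $1,\dots,n$ on its outer and $n+1,\dots,n+m$ on its inner boundary. Its universal cover is an infinite strip, whose lower boundary line covers the outer boundary and carries marked points $v_k$ ($k\in\mathbb Z$, from left to right), $v_k$ lying over the outer marked point congruent to $k$ modulo $n$; if $m\ge 1$, the upper line covers the inner boundary and carries marked points likewise. An arc of $A_{n,m}$ is an isotopy class (fixing end points) of curves without self-intersections, the end points possibly coinciding, which either join two marked points and are neither contractible nor isotopic to a boundary segment (finite arcs), or start at a marked point and spiral infinitely around the meridian, in one of the two directions (asymptotic arcs; their lifts tend to $-\infty$ or to $+\infty$ in the strip). Two arcs are compatible if they have representatives that do not intersect (except at common end points). A triangulation $T$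 of $A_{n,m}$ is a maximal collection of pairwise compatible arcs. Its preimage in the strip cuts out triangles, with vertices among the marked points and the two ends $\pm\infty$ of the strip. We say that $T$ realizes $(a_1,\dots,a_n)$ if, for $1\le k\le n$, exactly $a_k$ of these triangles are incident with $v_k$. **Corollary.** Let $\mathcal F=(m_{ij})$ be an infinite frieze of period $n\ge1$ with quiddity row $(a_i)_{i\in\mathbb Z}$, let $m\ge 0$, and let $T$ be a triangulation of $A_{n,m}$ realizing $(a_1,\dots,a_n)$. Then for all integers $i\le j$, the entry $m_{ij}$ is the (finite) number of matchings between the lower marked points $v_i,v_{i+1},\dots,v_j$ and the triangles of the lifted triangulation, that is, the number of ways to assign to each $v_k$ ($i\le k\le j$) a triangle incident with $v_k$ such that distinct points get distinct triangles. -/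

import Mathlib

/-- An infinite frieze of positive integers: an array `(m_{ij})` with `i, j ∈ ℤ` and `j ≥ i - 2`,
with a row of zeros, a row of ones, positive entries `m_{ij}` for `i ≤ j`, and the unimodular rule
for every diamond of the array. The values `entry i j` with `j < i - 2` are outside the array and
are not constrained. -/
structure InfiniteFrieze where
  entry : ℤ → ℤ → ℤ
  entry_zero : ∀ i, entry i (i - 2) = 0
  entry_one : ∀ i, entry i (i - 1) = 1
  entry_pos : ∀ i j, i ≤ j → 0 < entry i j
  unimodular : ∀ i j, i - 1 ≤ j →
    entry i j * entry (i + 1) (j + 1) - entry (i + 1) j * entry i (j + 1) = 1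

namespace InfiniteFrieze

/-- The quiddity row `a_i = m_{ii}`. -/
def quiddity (F : InfiniteFrieze) (i : ℤ) : ℤ := F.entry i i

/-- The frieze has period `n`: its quiddity row has period `n` (not necessarily the shortest). -/
def HasPeriod (F : InfiniteFrieze) (n : ℕ) : Prop :=
  ∀ i, F.quiddity (i + n) = F.quiddity i

end InfiniteFrieze

/-!
## The universal cover of the annulus

The annulus `A_{n,m}` has `n` marked points `1, …, n` on its outer boundary and `m` marked points
`n + 1, …, n + m` on its inner boundary. Its universal cover is a strip of height one.
-/

/-- The points at which lifts of arcs of the annulus to the strip may end: the marked points of the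
lower and of the upper boundary line, numbered from left to right, and the two ends `-∞`, `+∞` of
the strip. In coordinates, for `m > 0`, `lower k` is `((k - 1) m, 0)` and `upper k` is
`((k - 1) n, 1)`; for `m = 0`, `lower k` is `(k - 1, 0)`. So `lower k` lies over the outer marked
point `k` modulo `n`, and `upper k` lies over the inner marked point `n + (k mod m)`. -/
inductive StripPoint : Type
  | left : StripPoint
  | lower (k : ℤ) : StripPoint
  | right : StripPoint
  | upper (k : ℤ) : StripPoint

namespace StripPoint

/-- The place of a point on the boundary circle of the strip (compactified by its two ends), run
through counterclockwise from the left end: the left end, the lower line from left to right,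
the right end, the upper line from right to left. -/
def place : StripPoint → ℕ ×ₗ ℤ
  | left => toLex (0, 0)
  | lower k => toLex (1, k)
  | right => toLex (2, 0)
  | upper k => toLex (3, -k)

theorem place_injective : Function.Injective place := by
  intro p q h
  cases p <;> cases q <;> simp_all [place]

noncomputable instance : LinearOrder StripPoint := LinearOrder.lift' place place_injective

/-- The point is present in the cover of `A_{n,m}`: for `m = 0` there are no marked points on the
upper boundary. -/
def IsPresent (m : ℕ) : StripPoint → Prop
  | upper _ => 0 < m
  | _ => True

/-- The deck transformation number `t`: translation of the strip by `t` fundamental domains, each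
of which has `n` marked points below and `m` above. -/
def shift (n m : ℕ) (t : ℤ) : StripPoint → StripPoint
  | left => left
  | lower k => lower (k + t * n)
  | right => right
  | upper k => upper (k + t * m)

theorem shift_zero (n m : ℕ) : shift n m 0 = id := by
  funext p
  cases p <;> simp [shift]

theorem shift_comp (n m : ℕ) (s t : ℤ) : shift n m s ∘ shift n m t = shift n m (t + s) := by
  funext p
  cases p <;> simp [shift] <;> ring

end StripPoint

open StripPoint in
/-- The boundary segments of the strip: pairs of neighbouring marked points on one boundary. -/
def IsBoundarySegment (m : ℕ) (e : Sym2 StripPoint) : Prop :=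
  (∃ k, e = s(lower k, lower (k + 1))) ∨ (0 < m ∧ ∃ k, e = s(upper k, upper (k + 1)))

/-- Two curves of the strip given by their end points cross (have no representatives that are
disjoint away from common end points) if and only if their end points are linked on the boundary
circle of the strip. -/
def Crosses (e f : Sym2 StripPoint) : Prop :=
  ∃ a b c d : StripPoint, a < c ∧ c < b ∧ b < d ∧
    ((e = s(a, b) ∧ f = s(c, d)) ∨ (f = s(a, b) ∧ e = s(c, d)))

/-- The lifts to the strip of arcs of `A_{n,m}`. The strip is simply connected, so the
isotopy class of a curve in it is given by its (unordered) end points. A finite arc joins two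
marked points; it is peripheral if they are on the same boundary and bridging otherwise. An
asymptotic arc starts at a marked point and tends to `-∞` or `+∞`; in the annulus it spirals
around the meridian in one of the two directions. Contractible curves and boundary segments are
not arcs, nor is the curve from `-∞` to `+∞`, which covers the meridian. The last condition says
that the arc has no self-intersections in the annulus. -/
structure IsLiftedArc (n m : ℕ) (e : Sym2 StripPoint) : Prop where
  isPresent : ∀ p ∈ e, p.IsPresent m
  not_contractible : ¬ e.IsDiag
  not_meridian : e ≠ s(StripPoint.left, StripPoint.right)
  not_boundary : ¬ IsBoundarySegment m e
  simple : ∀ t : ℤ, ¬ Crosses e (e.map (StripPoint.shift n m t))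

/-- Two lifted arcs lie over the same arc of the annulus if a deck transformation takes one to the
other. -/
def deckSetoid (n m : ℕ) : Setoid {e : Sym2 StripPoint // IsLiftedArc n m e} where
  r e f := ∃ t : ℤ, e.1.map (StripPoint.shift n m t) = f.1
  iseqv :=
    { refl := fun e => ⟨0, by rw [StripPoint.shift_zero, Sym2.map_id, id]⟩
      symm := by
        rintro e f ⟨t, h⟩
        refine ⟨-t, ?_⟩
        rw [← h, Sym2.map_map, StripPoint.shift_comp, add_neg_cancel, StripPoint.shift_zero,
          Sym2.map_id, id]
      trans := by
        rintro e f g ⟨s, h⟩ ⟨t, h'⟩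
        exact ⟨s + t, by rw [← h', ← h, Sym2.map_map, StripPoint.shift_comp]⟩ }

/-- The arcs (isotopy classes) of the annulus `A_{n,m}`, finite and asymptotic ones. -/
def AnnulusArc (n m : ℕ) : Type := Quotient (deckSetoid n m)

namespace AnnulusArc

variable {n m : ℕ}

/-- The preimage in the strip of a set of arcs of the annulus. -/
def preimage (T : Set (AnnulusArc n m)) : Set (Sym2 StripPoint) :=
  {e | ∃ h : IsLiftedArc n m e, Quotient.mk (deckSetoid n m) ⟨e, h⟩ ∈ T}

/-- Two arcs of the annulus are compatible if no lift of the first crosses a lift of the second. -/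
def Compatible (α β : AnnulusArc n m) : Prop :=
  ∀ e ∈ preimage {α}, ∀ f ∈ preimage {β}, ¬ Crosses e f

/-- A triangulation of the annulus: a maximal collection of pairwise compatible arcs. -/
def IsTriangulation (T : Set (AnnulusArc n m)) : Prop :=
  Maximal (fun S : Set (AnnulusArc n m) => S.Pairwise Compatible) T

/-- A triangle of the lifted triangulation of the strip, given by its three vertices (marked points
or ends of the strip): any two of them are joined by a lifted arc or a boundary segment. As all
vertices lie on the boundary circle of the strip and as the arcs do not cross, no arc enters
the inside of such a triangle, so it is a region of the lifted triangulation. -/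
def IsTriangle (T : Set (AnnulusArc n m)) (t : Finset StripPoint) : Prop :=
  t.card = 3 ∧ ∀ p ∈ t, ∀ q ∈ t, p ≠ q → s(p, q) ∈ preimage T ∨ IsBoundarySegment m s(p, q)

/-- The number of triangles of the lifted triangulation incident with the lower marked point `k`.
The (outer) quiddity sequence of `T` consists of these numbers for `k = 1, …, n`. -/
noncomputable def quiddity (T : Set (AnnulusArc n m)) (k : ℤ) : ℕ :=
  {t : Finset StripPoint | IsTriangle T t ∧ StripPoint.lower k ∈ t}.ncard

/-- `T` realizes the quiddity sequence `(a_1, …, a_n)` of the frieze. -/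
def Realizes (T : Set (AnnulusArc n m)) (F : InfiniteFrieze) : Prop :=
  ∀ k : ℤ, 1 ≤ k → k ≤ n → (quiddity T k : ℤ) = F.quiddity k

/-- The matchings between the lower marked points `i, i + 1, …, j` and the triangles of the lifted
triangulation: each of the points is matched with a triangle incident with it, and different points
are matched with different triangles. -/
def matchings (T : Set (AnnulusArc n m)) (i j : ℤ) :
    Set (Finset.Icc i j → Finset StripPoint) :=
  {f | Function.Injective f ∧
    ∀ k : Finset.Icc i j, IsTriangle T (f k) ∧ StripPoint.lower (k : ℤ) ∈ f k}

end AnnulusArc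

theorem InfiniteFrieze.entry_eq_mul_sub (F : InfiniteFrieze) (i j : ℤ) (hij : i ≤ j) :
    F.entry i j = F.quiddity j * F.entry i (j - 1) - F.entry i (j - 2) := by
  obtain ⟨d, hd⟩ := Int.eq_ofNat_of_zero_le (sub_nonneg.2 hij)
  induction d generalizing i with
  | zero =>
    obtain rfl : j = i := by simpa [sub_eq_zero] using hd
    simp [F.entry_one, F.entry_zero, InfiniteFrieze.quiddity]
  | succ d ih =>
    push_cast at hd
    have h := ih (i + 1) (by omega) (by omega)
    have h1 := F.unimodular i (j - 1) (by omega)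
    have h2 := F.unimodular i (j - 2) (by omega)
    rw [show j - 1 + 1 = j by ring] at h1
    rw [show j - 2 + 1 = j - 1 by ring] at h2
    have h3 : F.entry (i + 1) (j - 1) ≠ 0 := by
      rcases eq_or_lt_of_le (show i ≤ j - 1 by omega) with h | h
      · have := F.entry_one (i + 1)
        rw [show i + 1 - 1 = j - 1 by omega] at this
        simp [this]
      · exact (F.entry_pos _ _ (by omega)).ne'
    apply mul_left_cancel₀ h3
    rw [h] at h1
    linear_combination h2 - h1

theorem Set.ncard_eq_sum_ncard_fiber {α β : Type*} {s : Set α} (hs : s.Finite) (t : Finset β)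
    (φ : α → β) (h : ∀ x ∈ s, φ x ∈ t) :
    s.ncard = ∑ b ∈ t, {x ∈ s | φ x = b}.ncard := by
  classical
  rw [Set.ncard_eq_toFinset_card s hs,
    Finset.card_eq_sum_card_fiberwise (f := φ) (t := t) (by simpa [Set.MapsTo] using h)]
  refine Finset.sum_congr rfl fun b _ => ?_
  rw [← Set.ncard_coe_finset]
  congr 1
  ext x
  simp

theorem Set.ncard_eq_ncard_add_ncard_not {α : Type*} {s : Set α} (hs : s.Finite) (p : α → Prop) :
    s.ncard = {x ∈ s | p x}.ncard + {x ∈ s | ¬ p x}.ncard := by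
  have := Set.ncard_inter_add_ncard_sdiff_eq_ncard s {x | p x} hs
  rw [← this]
  rfl

/-- The combinatorics of the triangles at the points of a line in a triangulation of a region
above the line: `fan k` is the set of triangles incident with the point `k`. -/
structure FanSystem (τ : Type*) where
  fan : ℤ → Finset τ
  exists_consecutive : ∀ k, ∃ t, t ∈ fan k ∧ t ∈ fan (k + 1)
  noncrossing : ∀ {p q r s : ℤ} {t u : τ}, p < q → q < r → r < s →
    t ∈ fan p → t ∈ fan r → u ∈ fan q → u ∈ fan s → False
  exists_above : ∀ {k l : ℤ} {t : τ}, k < l → t ∈ fan k → t ∈ fan l →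
    ∃ u, u ∈ fan k ∧ u ∈ fan l ∧ ∀ q, k < q → q < l → u ∉ fan q
  above_unique : ∀ {k l : ℤ} {t u : τ}, k < l → t ∈ fan k → t ∈ fan l → u ∈ fan k → u ∈ fan l →
    (∀ q, k < q → q < l → t ∉ fan q) → (∀ q, k < q → q < l → u ∉ fan q) → t = u
  exists_below : ∀ {k l : ℤ} {t : τ}, k + 1 < l → t ∈ fan k → t ∈ fan l →
    ∃ u q, k < q ∧ q < l ∧ u ∈ fan k ∧ u ∈ fan q ∧ u ∈ fan l
  below_unique : ∀ {k l q r : ℤ} {t u : τ}, k < q → q < l → k < r → r < l →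
    t ∈ fan k → t ∈ fan q → t ∈ fan l → u ∈ fan k → u ∈ fan r → u ∈ fan l → t = u
  confined : ∀ {k l q : ℤ} {t u : τ}, k < q → q < l → t ∈ fan k → t ∈ fan l → u ∈ fan q →
    ∃ p x r, k ≤ p ∧ p < x ∧ x < r ∧ r ≤ l ∧ u ∈ fan p ∧ u ∈ fan x ∧ u ∈ fan r

namespace FanSystem

variable {τ : Type*} (A : FanSystem τ)

/-- The points `k < l` have a common triangle. -/
def Adj (k l : ℤ) : Prop := k < l ∧ ∃ t, t ∈ A.fan k ∧ t ∈ A.fan l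

/-- The triangle `t` has three vertices on the line, `q` being the middle one. -/
def IsMid (q : ℤ) (t : τ) : Prop :=
  ∃ p r, p < q ∧ q < r ∧ t ∈ A.fan p ∧ t ∈ A.fan q ∧ t ∈ A.fan r

variable {A}

theorem adj_succ (k : ℤ) : A.Adj k (k + 1) := ⟨by omega, A.exists_consecutive k⟩

theorem IsMid.mem {q : ℤ} {t : τ} (h : A.IsMid q t) : t ∈ A.fan q := by
  obtain ⟨p, r, -, -, -, h, -⟩ := h
  exact h

theorem IsMid.eq {q : ℤ} {t u : τ} (ht : A.IsMid q t) (hu : A.IsMid q u) : t = u := by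
  obtain ⟨p, r, hpq, hqr, htp, htq, htr⟩ := ht
  obtain ⟨p', r', hpq', hqr', hup, huq, hur⟩ := hu
  have hp : p = p' := by
    rcases lt_trichotomy p p' with h | h | h
    · exact (A.noncrossing h hpq' hqr' htp htq hup hur).elim
    · exact h
    · exact (A.noncrossing h hpq hqr hup huq htp htr).elim
  have hr : r = r' := by
    rcases lt_trichotomy r r' with h | h | h
    · exact (A.noncrossing hpq hqr h htp htr huq hur).elim
    · exact h
    · exact (A.noncrossing hpq' hqr' h hup hur htq htr).elim
  subst hp hr
  exact A.below_unique hpq hqr hpq' hqr' htp htq htr hup huq hur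

theorem IsMid.point_eq {q r : ℤ} {t : τ} (hq : A.IsMid q t) (hr : A.IsMid r t) : q = r := by
  obtain ⟨p, s, h1, h2, h3, h4, h5⟩ := hq
  obtain ⟨p', s', h1', h2', h3', h4', h5'⟩ := hr
  rcases lt_trichotomy q r with h | h | h
  · exact (A.noncrossing h1 h h2' h3 h4' h4 h5').elim
  · exact h
  · exact (A.noncrossing h1' h h2 h3' h4 h4' h5).elim

theorem Adj.mem_Icc {k l q r : ℤ} {t : τ} (h : A.Adj k l) (hk : k < q) (hl : q < l)
    (hq : t ∈ A.fan q) (hr : t ∈ A.fan r) : k ≤ r ∧ r ≤ l := by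
  obtain ⟨-, u, huk, hul⟩ := h
  constructor
  · by_contra! hrk
    exact A.noncrossing hrk hk hl hr hq huk hul
  · by_contra! hlr
    exact A.noncrossing hk hl hlr huk hul hq hr

theorem Adj.exists_split {k l : ℤ} (h : A.Adj k l) (hkl : k + 1 < l) :
    ∃ u q, k < q ∧ q < l ∧ u ∈ A.fan k ∧ u ∈ A.fan q ∧ u ∈ A.fan l :=
  have ⟨_, _, h1, h2⟩ := h
  A.exists_below hkl h1 h2

theorem Adj.exists_isMid {k l : ℤ} (h : A.Adj k l) {q : ℤ} (hk : k < q) (hl : q < l) :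
    ∃ t, A.IsMid q t := by
  obtain ⟨d, hd⟩ := Int.eq_ofNat_of_zero_le (sub_nonneg.2 h.1.le)
  induction d using Nat.strong_induction_on generalizing k l with
  | _ d ih =>
    obtain ⟨u, x, hkx, hxl, huk, hux, hul⟩ := h.exists_split (by omega)
    rcases lt_trichotomy q x with hq | rfl | hq
    · exact ih (x - k).toNat (by omega) ⟨hkx, u, huk, hux⟩ hk hq (by omega)
    · exact ⟨u, k, l, hk, hl, huk, hux, hul⟩
    · exact ih (l - x).toNat (by omega) ⟨hxl, u, hux, hul⟩ hq hl (by omega)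

/-- There is only one way to match the points strictly between two adjacent points. -/
theorem Adj.isMid_of_injOn {k l : ℤ} (h : A.Adj k l) {f : ℤ → τ}
    (hf : Set.InjOn f (Set.Ioo k l)) (hfan : ∀ q ∈ Set.Ioo k l, f q ∈ A.fan q) :
    ∀ q ∈ Set.Ioo k l, A.IsMid q (f q) := by
  obtain ⟨d, hd⟩ := Int.eq_ofNat_of_zero_le (sub_nonneg.2 h.1.le)
  induction d using Nat.strong_induction_on generalizing k l with
  | _ d ih =>
    rintro q ⟨hk, hl⟩
    obtain ⟨u, x, hkx, hxl, huk, hux, hul⟩ := h.exists_split (by omega)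
    have hmid : A.IsMid x u := ⟨k, l, hkx, hxl, huk, hux, hul⟩
    have hex : ∀ y ∈ Set.Ioo k l, ∃ z ∈ Set.Ioo k l, A.IsMid z (f y) := by
      intro y hy
      obtain ⟨p, z, r, h1, h2, h3, h4, h5, h6, h7⟩ := A.confined hy.1 hy.2 huk hul (hfan y hy)
      exact ⟨z, ⟨by omega, by omega⟩, p, r, h2, h3, h5, h6, h7⟩
    choose! z hz hzmid using hex
    have hinj : Set.InjOn z (Set.Ioo k l) := by
      intro y hy y' hy' hyy
      apply hf hy hy'
      have h2 := hzmid y' hy'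
      rw [← hyy] at h2
      exact (hzmid y hy).eq h2
    obtain ⟨y, hy, hyx⟩ :=
      ((Set.finite_Ioo k l).injOn_iff_bijOn_of_mapsTo hz).1 hinj |>.surjOn ⟨hkx, hxl⟩
    have hfy : f y = u := by
      have := hzmid y hy
      rw [hyx] at this
      exact this.eq hmid
    have hyx : y = x := by
      have huy : u ∈ A.fan y := hfy ▸ hfan y hy
      exact IsMid.point_eq ⟨k, l, hy.1, hy.2, huk, huy, hul⟩ hmid
    subst hyx
    rcases lt_trichotomy q y with hq | rfl | hq
    · exact ih (y - k).toNat (by omega) ⟨hkx, u, huk, hux⟩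
        (hf.mono (Set.Ioo_subset_Ioo_right hxl.le))
        (fun q hq => hfan q ⟨hq.1, hq.2.trans hxl⟩) (by omega) q ⟨hk, hq⟩
    · rwa [hfy]
    · exact ih (l - y).toNat (by omega) ⟨hxl, u, hux, hul⟩
        (hf.mono (Set.Ioo_subset_Ioo_left hkx.le))
        (fun q hq => hfan q ⟨hkx.trans hq.1, hq.2⟩) (by omega) q ⟨hq, hl⟩

variable (A) in
open Classical in
/-- The triangle with middle vertex `q`, if there is one. -/
noncomputable def mid (q : ℤ) : τ :=
  if h : ∃ t, A.IsMid q t then h.choose else (A.exists_consecutive q).choose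

theorem IsMid.eq_mid {q : ℤ} {t : τ} (h : A.IsMid q t) : t = A.mid q := by
  have h' : ∃ t, A.IsMid q t := ⟨t, h⟩
  rw [mid, dif_pos h']
  exact h.eq h'.choose_spec

theorem Adj.isMid_mid {k l : ℤ} (h : A.Adj k l) {q : ℤ} (hk : k < q) (hl : q < l) :
    A.IsMid q (A.mid q) := by
  obtain ⟨t, ht⟩ := h.exists_isMid hk hl
  exact ht.eq_mid ▸ ht

variable (A) in
/-- The matchings of the points `i, …, j - 1`, extended to all points by `mid`. -/
def matchings (i j : ℤ) : Set (ℤ → τ) :=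
  {f | Set.InjOn f (Set.Ico i j) ∧ (∀ k ∈ Set.Ico i j, f k ∈ A.fan k) ∧
    ∀ k ∉ Set.Ico i j, f k = A.mid k}

theorem finite_matchings (i j : ℤ) : (A.matchings i j).Finite := by
  let ρ : (ℤ → τ) → (Set.Ico i j → τ) := fun f k => f k
  refine Set.Finite.of_finite_image (f := ρ) ?_ ?_
  · refine Set.Finite.subset (Set.Finite.pi' (ι := Set.Ico i j) (t := fun k => (A.fan k : Set τ))
      fun k => (A.fan k).finite_toSet) ?_
    rintro _ ⟨f, hf, rfl⟩ k
    exact hf.2.1 k k.2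
  · intro f hf g hg hfg
    funext k
    by_cases hk : k ∈ Set.Ico i j
    · exact congrFun hfg ⟨k, hk⟩
    · rw [hf.2.2 k hk, hg.2.2 k hk]

theorem matchings_self (i : ℤ) : A.matchings i i = {A.mid} := by
  ext f
  simp [matchings, funext_iff]

/-- In a matching of `i, …, l - 1` that takes `t` at `k`, where `k` and `l` are adjacent and `t`
lies above, only the triangles at `i, …, k - 1` may be chosen. -/
theorem Adj.ncard_matchings_eq_at {i k l : ℤ} (h : A.Adj k l) (hik : i ≤ k) {t : τ}
    (ht : t ∈ A.fan k) (hab : ∀ q, k < q → q < l → t ∉ A.fan q) :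
    {f ∈ A.matchings i l | f k = t}.ncard =
      {f ∈ A.matchings i k | ∀ q ∈ Set.Ico i k, f q ≠ t}.ncard := by
  have hkl := h.1
  refine Set.ncard_congr (fun f _ => Function.update f k (A.mid k)) ?_ ?_ ?_
  · rintro f ⟨⟨hinj, hfan, hmid⟩, hfk⟩
    have hne : ∀ q ∈ Set.Ico i k, q ≠ k := fun q hq => hq.2.ne
    have hsub : Set.Ico i k ⊆ Set.Ico i l := Set.Ico_subset_Ico_right hkl.le
    refine ⟨⟨?_, ?_, ?_⟩, ?_⟩
    · intro q hq r hr hqr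
      rw [Function.update_of_ne (hne q hq), Function.update_of_ne (hne r hr)] at hqr
      exact hinj (hsub hq) (hsub hr) hqr
    · intro q hq
      rw [Function.update_of_ne (hne q hq)]
      exact hfan q (hsub hq)
    · intro q hq
      rcases eq_or_ne q k with rfl | hqk
      · simp
      rw [Function.update_of_ne hqk]
      by_cases hql : q ∈ Set.Ico i l
      · have hq' : q ∈ Set.Ioo k l := by
          simp only [Set.mem_Ico, Set.mem_Ioo] at *
          omega
        have hIoo : Set.Ioo k l ⊆ Set.Ico i l := fun x hx => ⟨by have := hx.1; omega, hx.2⟩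
        exact (h.isMid_of_injOn (hinj.mono hIoo) (fun x hx => hfan x (hIoo hx)) q hq').eq_mid
      · exact hmid q hql
    · intro q hq hqt
      rw [Function.update_of_ne (hne q hq), ← hfk] at hqt
      exact hne q hq (hinj (hsub hq) ⟨hik, hkl⟩ hqt)
  · rintro f g ⟨-, hf⟩ ⟨-, hg⟩ hfg
    funext q
    rcases eq_or_ne q k with rfl | hq
    · rw [hf, hg]
    · simpa [hq] using congrFun hfg q
  · rintro f ⟨⟨hinj, hfan, hmid⟩, hav⟩
    have hout : ∀ q, k < q → f q = A.mid q := fun q hq => hmid q fun hq' => by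
      have := hq'.2
      omega
    have hin : ∀ q, k < q → q < l → A.IsMid q (f q) := fun q hq hq' => by
      rw [hout q hq]
      exact h.isMid_mid hq hq'
    have key : ∀ q r, i ≤ q → q < r → r < l →
        Function.update f k t q ≠ Function.update f k t r := by
      intro q r hiq hqr hrl heq
      rcases lt_trichotomy r k with hrk | rfl | hrk
      · rw [Function.update_of_ne (by omega), Function.update_of_ne (by omega)] at heq
        have := hinj ⟨hiq, by omega⟩ ⟨by omega, hrk⟩ heq
        omega
      · rw [Function.update_of_ne (by omega), Function.update_self] at heq
        exact hav q ⟨hiq, hqr⟩ heq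
      · have hr := hin r hrk hrl
        rw [Function.update_of_ne (show r ≠ k by omega)] at heq
        rcases lt_trichotomy q k with hqk | rfl | hqk
        · rw [Function.update_of_ne (by omega)] at heq
          have hq := hfan q ⟨hiq, hqk⟩
          rw [heq] at hq
          have := (h.mem_Icc hrk hrl hr.mem hq).1
          omega
        · rw [Function.update_self] at heq
          exact hab r hrk hrl (heq ▸ hr.mem)
        · rw [Function.update_of_ne (by omega)] at heq
          have hq := hin q hqk (by omega)
          rw [heq] at hq
          have := hq.point_eq hr
          omega
    refine ⟨Function.update f k t, ⟨⟨?_, ?_, ?_⟩, by simp⟩, ?_⟩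
    · intro q hq r hr heq
      rcases lt_trichotomy q r with h' | h' | h'
      · exact (key q r hq.1 h' hr.2 heq).elim
      · exact h'
      · exact (key r q hr.1 h' hq.2 heq.symm).elim
    · intro q hq
      rcases lt_trichotomy q k with hqk | rfl | hqk
      · rw [Function.update_of_ne (by omega)]
        exact hfan q ⟨hq.1, hqk⟩
      · simpa using ht
      · rw [Function.update_of_ne (by omega)]
        exact (hin q hqk hq.2).mem
    · intro q hq
      have hqk : q ≠ k := by
        rintro rfl
        exact hq ⟨hik, hkl⟩
      rw [Function.update_of_ne hqk]
      exact hmid q fun h' => hq ⟨h'.1, h'.2.trans hkl⟩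
    · rw [Function.update_idem]
      funext q
      rcases eq_or_ne q k with rfl | hq
      · simp [hmid]
      · simp [hq]

theorem ncard_matchings_add_ncard {i j : ℤ} (t : τ) :
    (A.matchings i j).ncard = {f ∈ A.matchings i j | ∃ q ∈ Set.Ico i j, f q = t}.ncard +
      {f ∈ A.matchings i j | ∀ q ∈ Set.Ico i j, f q ≠ t}.ncard := by
  rw [Set.ncard_eq_ncard_add_ncard_not (A.finite_matchings i j) fun f => ∃ q ∈ Set.Ico i j, f q = t]
  simp

theorem matchings_avoiding {i j : ℤ} {t : τ} (ht : ∀ q ∈ Set.Ico i j, t ∉ A.fan q) :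
    {f ∈ A.matchings i j | ∀ q ∈ Set.Ico i j, f q ≠ t} = A.matchings i j := by
  refine Set.sep_eq_self_iff_mem_true.2 fun f hf q hq hqt => ht q hq ?_
  exact hqt ▸ hf.2.1 q hq

theorem ncard_matchings_succ {i j : ℤ} (hij : i ≤ j) :
    (A.matchings i (j + 1)).ncard =
      ∑ t ∈ A.fan j, {f ∈ A.matchings i j | ∀ q ∈ Set.Ico i j, f q ≠ t}.ncard := by
  rw [Set.ncard_eq_sum_ncard_fiber (A.finite_matchings i (j + 1)) (A.fan j) (fun f => f j)
    fun f hf => hf.2.1 j ⟨hij, by omega⟩]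
  refine Finset.sum_congr rfl fun t ht => ?_
  exact (adj_succ j).ncard_matchings_eq_at hij ht fun q h1 h2 => by omega

open Classical in
/-- The number of matchings of `i, …, j - 1` that use a given triangle at `j`. -/
theorem ncard_matchings_using {i j : ℤ} {t : τ} (ht : t ∈ A.fan j) :
    ({f ∈ A.matchings i j | ∃ q ∈ Set.Ico i j, f q = t}.ncard : ℤ) =
      ∑ k ∈ Finset.Ico i j with t ∈ A.fan k ∧ ∀ q, k < q → q < j → t ∉ A.fan q,
        ((A.matchings i k).ncard : ℤ) -
      ∑ k ∈ Finset.Ico i j with t ∈ A.fan k ∧ ∃ q, k < q ∧ q < j ∧ t ∈ A.fan q,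
        ((A.matchings i k).ncard : ℤ) := by
  by_cases h0 : ∃ k, i ≤ k ∧ k < j ∧ t ∈ A.fan k
  swap
  · push Not at h0
    rw [Finset.filter_false_of_mem, Finset.filter_false_of_mem]
    · simp only [Finset.sum_empty, sub_zero, Nat.cast_eq_zero]
      rw [Set.ncard_eq_zero ((A.finite_matchings i j).subset (Set.sep_subset _ _))]
      refine Set.eq_empty_of_forall_notMem ?_
      rintro f ⟨hf, q, hq, rfl⟩
      exact h0 q hq.1 hq.2 (hf.2.1 q hq)
    · rintro k hk ⟨h, -⟩
      rw [Finset.mem_Ico] at hk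
      exact h0 k hk.1 hk.2 h
    · rintro k hk ⟨h, -⟩
      rw [Finset.mem_Ico] at hk
      exact h0 k hk.1 hk.2 h
  obtain ⟨k, ⟨hik, hkj, htk⟩, hmax⟩ := Int.exists_greatest_of_bdd
    (P := fun k => i ≤ k ∧ k < j ∧ t ∈ A.fan k) ⟨j, fun z hz => hz.2.1.le⟩ h0
  have hab : ∀ q, k < q → q < j → t ∉ A.fan q := fun q h1 h2 h3 => by
    have := hmax q ⟨by omega, h2, h3⟩
    omega
  have hadj : A.Adj k j := ⟨hkj, t, htk, ht⟩
  have hK : (Finset.Ico i j).filter (fun k => t ∈ A.fan k ∧ ∀ q, k < q → q < j → t ∉ A.fan q) =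
      {k} := by
    ext l
    simp only [Finset.mem_filter, Finset.mem_Ico, Finset.mem_singleton]
    constructor
    · rintro ⟨⟨h1, h2⟩, h3, h4⟩
      have := hmax l ⟨h1, h2, h3⟩
      by_contra hlk
      exact h4 k (by omega) hkj htk
    · rintro rfl
      exact ⟨⟨hik, hkj⟩, htk, hab⟩
  have hU : {f ∈ A.matchings i j | ∃ q ∈ Set.Ico i j, f q = t} = {f ∈ A.matchings i j | f k = t} := by
    ext f
    constructor
    · rintro ⟨hf, x, hx, hfx⟩
      refine ⟨hf, ?_⟩
      have htx : t ∈ A.fan x := hfx ▸ hf.2.1 x hx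
      have hxk : x ≤ k := hmax x ⟨hx.1, hx.2, htx⟩
      rcases hxk.eq_or_lt with rfl | hxk
      · exact hfx
      · have hIoo : Set.Ioo x j ⊆ Set.Ico i j := fun y hy => ⟨hx.1.trans hy.1.le, hy.2⟩
        have h1 := Adj.isMid_of_injOn ⟨hx.2, t, htx, ht⟩ (hf.1.mono hIoo)
          (fun y hy => hf.2.1 y (hIoo hy)) k ⟨hxk, hkj⟩
        exact h1.eq ⟨x, j, hxk, hkj, htx, htk, ht⟩
    · rintro ⟨hf, hfk⟩
      exact ⟨hf, k, ⟨hik, hkj⟩, hfk⟩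
  rw [hK, Finset.sum_singleton, hU, hadj.ncard_matchings_eq_at hik htk hab,
    ncard_matchings_add_ncard (A := A) (i := i) (j := k) t]
  by_cases h1 : ∃ x, i ≤ x ∧ x < k ∧ t ∈ A.fan x
  · obtain ⟨x, hix, hxk, htx⟩ := h1
    have honly : ∀ l, l < k → t ∈ A.fan l → l = x := by
      intro l hl htl
      rcases lt_trichotomy l x with h | h | h
      · exact (A.noncrossing h hxk hkj htl htk htx ht).elim
      · exact h
      · exact (A.noncrossing h hl hkj htx htk htl ht).elim
    have hX : (Finset.Ico i j).filter (fun k => t ∈ A.fan k ∧ ∃ q, k < q ∧ q < j ∧ t ∈ A.fan q) =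
        {x} := by
      ext l
      simp only [Finset.mem_filter, Finset.mem_Ico, Finset.mem_singleton]
      constructor
      · rintro ⟨⟨h1, h2⟩, h3, q, h4, h5, h6⟩
        have := hmax q ⟨by omega, h5, h6⟩
        exact honly l (by omega) h3
      · rintro rfl
        exact ⟨⟨hix, by omega⟩, htx, k, hxk, hkj, htk⟩
    have hV : {f ∈ A.matchings i k | ∃ q ∈ Set.Ico i k, f q = t} =
        {f ∈ A.matchings i k | f x = t} := by
      ext f
      constructor
      · rintro ⟨hf, y, hy, hfy⟩
        have := honly y hy.2 (hfy ▸ hf.2.1 y hy)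
        subst this
        exact ⟨hf, hfy⟩
      · rintro ⟨hf, hfx⟩
        exact ⟨hf, x, ⟨hix, hxk⟩, hfx⟩
    rw [hX, Finset.sum_singleton, hV,
      Adj.ncard_matchings_eq_at ⟨hxk, t, htx, htk⟩ hix htx,
      matchings_avoiding (i := i) (j := x)]
    · push_cast
      ring
    · intro q hq htq
      have := honly q (hq.2.trans hxk) htq
      have := hq.2
      omega
    · intro q h1 h2 htq
      have := honly q h2 htq
      omega
  · push Not at h1
    have hX : (Finset.Ico i j).filter (fun k => t ∈ A.fan k ∧ ∃ q, k < q ∧ q < j ∧ t ∈ A.fan q) =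
        ∅ := by
      refine Finset.filter_false_of_mem ?_
      rintro l hl ⟨htl, q, h2, h3, h4⟩
      rw [Finset.mem_Ico] at hl
      have := hmax q ⟨by omega, h3, h4⟩
      exact h1 l hl.1 (by omega) htl
    have hV : {f ∈ A.matchings i k | ∃ q ∈ Set.Ico i k, f q = t} = ∅ := by
      refine Set.eq_empty_of_forall_notMem ?_
      rintro f ⟨hf, q, hq, rfl⟩
      exact h1 q hq.1 hq.2 (hf.2.1 q hq)
    rw [hX, hV]
    simp

open Classical in
theorem ncard_matchings_recurrence {i j : ℤ} (hij : i < j) :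
    ((A.matchings i (j + 1)).ncard : ℤ) =
      (A.fan j).card * (A.matchings i j).ncard - (A.matchings i (j - 1)).ncard := by
  have hsum : ∑ t ∈ A.fan j,
      ({f ∈ A.matchings i j | ∃ q ∈ Set.Ico i j, f q = t}.ncard : ℤ) =
        (A.matchings i (j - 1)).ncard := by
    rw [Finset.sum_congr rfl fun t ht => ncard_matchings_using ht, Finset.sum_sub_distrib]
    simp only [Finset.sum_filter]
    rw [Finset.sum_comm, Finset.sum_comm (s := A.fan j), ← Finset.sum_sub_distrib]
    rw [Finset.sum_eq_single (j - 1)]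
    · obtain ⟨u, hu, hu'⟩ := A.exists_consecutive (j - 1)
      rw [sub_add_cancel] at hu'
      rw [Finset.sum_eq_single u]
      · rw [if_pos ⟨hu, fun q h1 h2 => by omega⟩, Finset.sum_eq_zero, sub_zero]
        intro t ht
        refine if_neg ?_
        rintro ⟨-, q, h1, h2, -⟩
        omega
      · intro t ht htu
        refine if_neg ?_
        rintro ⟨h1, h2⟩
        exact htu (A.above_unique (by omega) h1 ht hu hu' h2 fun q h1 h2 => by omega)
      · exact fun h => (h hu').elim
    · intro k hk hkj
      rw [Finset.mem_Ico] at hk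
      by_cases hadj : A.Adj k j
      · obtain ⟨hkj', t, htk, htj⟩ := hadj
        obtain ⟨u, huk, huj, hu⟩ := A.exists_above hkj' htk htj
        obtain ⟨v, x, h1, h2, hvk, hvx, hvj⟩ := A.exists_below (by omega) htk htj
        rw [Finset.sum_eq_single u, Finset.sum_eq_single v, if_pos ⟨huk, hu⟩,
          if_pos ⟨hvk, x, h1, h2, hvx⟩, sub_self]
        · intro w hw hwv
          refine if_neg ?_
          rintro ⟨hwk, y, hy, hy', hwy⟩
          exact hwv (A.below_unique hy hy' h1 h2 hwk hwy hw hvk hvx hvj)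
        · exact fun h => (h hvj).elim
        · intro w hw hwu
          refine if_neg ?_
          rintro ⟨hwk, h⟩
          exact hwu (A.above_unique hkj' hwk hw huk huj h hu)
        · exact fun h => (h huj).elim
      · rw [Finset.sum_eq_zero, Finset.sum_eq_zero, sub_zero]
        · exact fun t ht => if_neg fun h => hadj ⟨hk.2, t, h.1, ht⟩
        · exact fun t ht => if_neg fun h => hadj ⟨hk.2, t, h.1, ht⟩
    · intro h
      simp only [Finset.mem_Ico, not_and, not_lt] at h
      omega
  rw [ncard_matchings_succ hij.le, ← hsum, Nat.cast_sum, eq_sub_iff_add_eq,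
    ← Finset.sum_add_distrib, ← nsmul_eq_mul, ← Finset.sum_const]
  refine Finset.sum_congr rfl fun t _ => ?_
  rw [ncard_matchings_add_ncard t]
  push_cast
  ring

theorem ncard_matchings_eq_entry (F : InfiniteFrieze) (hF : ∀ k, ((A.fan k).card : ℤ) = F.quiddity k)
    {i j : ℤ} (hij : i ≤ j) : ((A.matchings i j).ncard : ℤ) = F.entry i (j - 1) ∧
      ((A.matchings i (j + 1)).ncard : ℤ) = F.entry i j := by
  induction j, hij using Int.leInduction with
  | base =>
    rw [ncard_matchings_succ le_rfl, matchings_self, F.entry_one]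
    refine ⟨by simp, ?_⟩
    rw [show F.entry i i = F.quiddity i from rfl, ← hF]
    simp
  | succ j hij ih =>
    refine ⟨by simpa using ih.2, ?_⟩
    rw [ncard_matchings_recurrence (by omega), F.entry_eq_mul_sub i (j + 1) (by omega), hF]
    simp only [add_sub_cancel_right, show j + 1 - 2 = j - 1 by ring, ih]

end FanSystem

namespace StripPoint

variable {n m : ℕ}

theorem lt_iff_place_lt {p q : StripPoint} : p < q ↔ place p < place q := Iff.rfl

@[simp] theorem lower_lt_lower {k l : ℤ} : lower k < lower l ↔ k < l := by
  simp [lt_iff_place_lt, place, Prod.Lex.toLex_lt_toLex]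

@[simp] theorem upper_lt_upper {k l : ℤ} : upper k < upper l ↔ l < k := by
  simp [lt_iff_place_lt, place, Prod.Lex.toLex_lt_toLex]

@[simp] theorem left_lt_lower {k : ℤ} : left < lower k := by
  simp [lt_iff_place_lt, place, Prod.Lex.toLex_lt_toLex]

@[simp] theorem left_lt_right : left < right := by
  simp [lt_iff_place_lt, place, Prod.Lex.toLex_lt_toLex]

@[simp] theorem left_lt_upper {k : ℤ} : left < upper k := by
  simp [lt_iff_place_lt, place, Prod.Lex.toLex_lt_toLex]

@[simp] theorem lower_lt_right {k : ℤ} : lower k < right := by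
  simp [lt_iff_place_lt, place, Prod.Lex.toLex_lt_toLex]

@[simp] theorem lower_lt_upper {k l : ℤ} : lower k < upper l := by
  simp [lt_iff_place_lt, place, Prod.Lex.toLex_lt_toLex]

@[simp] theorem right_lt_upper {k : ℤ} : right < upper k := by
  simp [lt_iff_place_lt, place, Prod.Lex.toLex_lt_toLex]

@[simp] theorem not_lt_left {p : StripPoint} : ¬ p < left := by
  cases p <;> simp [lt_iff_place_lt, place, Prod.Lex.toLex_lt_toLex]

@[simp] theorem not_right_lt_lower {k : ℤ} : ¬ right < lower k := lower_lt_right.le.not_gt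

@[simp] theorem not_upper_lt_lower {k l : ℤ} : ¬ upper l < lower k := lower_lt_upper.le.not_gt

@[simp] theorem not_upper_lt_right {k : ℤ} : ¬ upper k < right := right_lt_upper.le.not_gt

theorem shift_strictMono (t : ℤ) : StrictMono (shift n m t) := by
  intro p q h
  cases p <;> cases q <;> simp_all [shift]

theorem IsPresent.shift {p : StripPoint} (h : p.IsPresent m) (t : ℤ) :
    (p.shift n m t).IsPresent m := by
  cases p <;> simp_all [StripPoint.shift, IsPresent]

theorem map_shift_neg_map_shift (t : ℤ) (e : Sym2 StripPoint) :
    (e.map (shift n m t)).map (shift n m (-t)) = e := by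
  rw [Sym2.map_map, shift_comp, add_neg_cancel, shift_zero, Sym2.map_id, id]

theorem map_shift_comm (s t : ℤ) (e : Sym2 StripPoint) :
    (e.map (shift n m t)).map (shift n m s) = (e.map (shift n m s)).map (shift n m t) := by
  rw [Sym2.map_map, Sym2.map_map, shift_comp, shift_comp, add_comm]

theorem eq_lower_of_between {k l : ℤ} {x : StripPoint} (h1 : lower k ≤ x) (h2 : x ≤ lower l) :
    ∃ q, x = lower q ∧ k ≤ q ∧ q ≤ l := by
  rw [← not_lt] at h1 h2
  cases x <;> simp_all

end StripPoint

open StripPoint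

theorem Crosses.symm {e f : Sym2 StripPoint} (h : Crosses e f) : Crosses f e := by
  obtain ⟨a, b, c, d, h1, h2, h3, h⟩ := h
  exact ⟨a, b, c, d, h1, h2, h3, h.symm⟩

theorem crosses_mk {a b c d : StripPoint} (h1 : a < c) (h2 : c < b) (h3 : b < d) :
    Crosses s(a, b) s(c, d) :=
  ⟨a, b, c, d, h1, h2, h3, Or.inl ⟨rfl, rfl⟩⟩

theorem Crosses.exists_eq_mk {x y : StripPoint} {f : Sym2 StripPoint} (hxy : x < y)
    (h : Crosses s(x, y) f) :
    ∃ c d, f = s(c, d) ∧ (x < c ∧ c < y ∧ y < d ∨ c < x ∧ x < d ∧ d < y) := by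
  have key : ∀ {a b : StripPoint}, a < b → s(x, y) = s(a, b) → x = a ∧ y = b := by
    intro a b hab h
    rcases Sym2.eq_iff.1 h with h | ⟨rfl, rfl⟩
    · exact h
    · exact absurd hab hxy.not_gt
  obtain ⟨a, b, c, d, h1, h2, h3, ⟨h, rfl⟩ | ⟨rfl, h⟩⟩ := h
  · obtain ⟨rfl, rfl⟩ := key (h1.trans h2) h
    exact ⟨c, d, rfl, Or.inl ⟨h1, h2, h3⟩⟩
  · obtain ⟨rfl, rfl⟩ := key (h2.trans h3) h
    exact ⟨a, b, rfl, Or.inr ⟨h1, h2, h3⟩⟩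

theorem Crosses.map_shift {n m : ℕ} {e f : Sym2 StripPoint} (h : Crosses e f) (t : ℤ) :
    Crosses (e.map (shift n m t)) (f.map (shift n m t)) := by
  have hmono := shift_strictMono (n := n) (m := m) t
  obtain ⟨a, b, c, d, h1, h2, h3, h⟩ := h
  refine ⟨_, _, _, _, hmono h1, hmono h2, hmono h3, ?_⟩
  rcases h with ⟨rfl, rfl⟩ | ⟨rfl, rfl⟩
  · exact Or.inl ⟨rfl, rfl⟩
  · exact Or.inr ⟨rfl, rfl⟩

theorem IsBoundarySegment.map_shift {n m : ℕ} {e : Sym2 StripPoint} (h : IsBoundarySegment m e)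
    (t : ℤ) : IsBoundarySegment m (e.map (shift n m t)) := by
  rcases h with ⟨k, rfl⟩ | ⟨hm, k, rfl⟩
  · exact Or.inl ⟨k + t * n, by simp [shift, add_right_comm]⟩
  · exact Or.inr ⟨hm, k + t * m, by simp [shift, add_right_comm]⟩

theorem IsBoundarySegment.not_crosses {m : ℕ} {e f : Sym2 StripPoint} (h : IsBoundarySegment m e) :
    ¬ Crosses e f := by
  intro hef
  rcases h with ⟨k, rfl⟩ | ⟨hm, k, rfl⟩
  · obtain ⟨c, d, -, ⟨h1, h2, -⟩ | ⟨-, h1, h2⟩⟩ := hef.exists_eq_mk (by simp)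
    · cases c <;> simp_all; omega
    · cases d <;> simp_all; omega
  · rw [Sym2.eq_swap] at hef
    obtain ⟨c, d, -, ⟨h1, h2, -⟩ | ⟨-, h1, h2⟩⟩ := hef.exists_eq_mk (by simp)
    · cases c <;> simp_all; omega
    · cases d <;> simp_all; omega

theorem isBoundarySegment_lower {m : ℕ} {k l : ℤ} (h : k < l) :
    IsBoundarySegment m s(lower k, lower l) ↔ l = k + 1 := by
  constructor
  · rintro (⟨a, ha⟩ | ⟨-, a, ha⟩)
    · simp only [Sym2.eq_iff, lower.injEq] at ha
      omega
    · simp at ha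
  · rintro rfl
    exact Or.inl ⟨k, rfl⟩

namespace IsLiftedArc

variable {n m : ℕ}

theorem map_shift {e : Sym2 StripPoint} (h : IsLiftedArc n m e) (t : ℤ) :
    IsLiftedArc n m (e.map (shift n m t)) where
  isPresent := by
    intro p hp
    obtain ⟨q, hq, rfl⟩ := Sym2.mem_map.1 hp
    exact (h.isPresent q hq).shift t
  not_contractible := by
    rw [Sym2.isDiag_map (shift_strictMono t).injective]
    exact h.not_contractible
  not_meridian := by
    intro h'
    apply h.not_meridian
    rw [← map_shift_neg_map_shift (n := n) (m := m) t e, h']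
    rfl
  not_boundary := by
    intro h'
    apply h.not_boundary
    rw [← map_shift_neg_map_shift (n := n) (m := m) t e]
    exact h'.map_shift _
  simple := by
    intro s h'
    apply h.simple s
    rw [map_shift_comm] at h'
    have := h'.map_shift (n := n) (m := m) (-t)
    rwa [map_shift_neg_map_shift, map_shift_neg_map_shift] at this

theorem lower_lower {p q : ℤ} (hpq : p + 1 < q) (hn : q - p ≤ n) :
    IsLiftedArc n m s(lower p, lower q) where
  isPresent := by simp [IsPresent]
  not_contractible := by simp; omega
  not_meridian := by simp
  not_boundary := by rw [isBoundarySegment_lower] <;> omega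
  simple := by
    intro t ht
    have hlt : lower p < lower q := by simp; omega
    have key : ∀ c d : ℤ, c = p + t * n → d = q + t * n →
        ¬ (p < c ∧ c < q ∧ q < d ∨ c < p ∧ p < d ∧ d < q) := by
      intro c d hc hd
      rcases lt_trichotomy t 0 with h | rfl | h
      · have : t * n ≤ -n := by nlinarith
        omega
      · omega
      · have : (n : ℤ) ≤ t * n := by nlinarith
        omega
    obtain ⟨c, d, h, h'⟩ := ht.exists_eq_mk hlt
    simp only [Sym2.map_mk, shift, Sym2.eq_iff] at h
    rcases h with ⟨rfl, rfl⟩ | ⟨rfl, rfl⟩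
    · exact key _ _ rfl rfl (by simpa using h')
    · simp only [lower_lt_lower] at h'
      omega

theorem left_lower (r : ℤ) : IsLiftedArc n m s(left, lower r) where
  isPresent := by simp [IsPresent]
  not_contractible := by simp
  not_meridian := by simp
  not_boundary := by simp [IsBoundarySegment]
  simple := by
    intro t ht
    obtain ⟨c, d, h, h'⟩ := ht.exists_eq_mk left_lt_lower
    simp only [Sym2.map_mk, shift, Sym2.eq_iff] at h
    rcases h with ⟨rfl, rfl⟩ | ⟨rfl, rfl⟩ <;> simp at h'

theorem lower_right (r : ℤ) : IsLiftedArc n m s(lower r, right) where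
  isPresent := by simp [IsPresent]
  not_contractible := by simp
  not_meridian := by simp
  not_boundary := by simp [IsBoundarySegment]
  simple := by
    intro t ht
    obtain ⟨c, d, h, h'⟩ := ht.exists_eq_mk lower_lt_right
    simp only [Sym2.map_mk, shift, Sym2.eq_iff] at h
    rcases h with ⟨rfl, rfl⟩ | ⟨rfl, rfl⟩ <;> simp at h'

theorem lower_upper (hm : 0 < m) (r u : ℤ) : IsLiftedArc n m s(lower r, upper u) where
  isPresent := by simp [IsPresent, hm]
  not_contractible := by simp
  not_meridian := by simp
  not_boundary := by simp [IsBoundarySegment]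
  simple := by
    intro t ht
    obtain ⟨c, d, h, h'⟩ := ht.exists_eq_mk lower_lt_upper
    simp only [Sym2.map_mk, shift, Sym2.eq_iff] at h
    rcases h with ⟨rfl, rfl⟩ | ⟨rfl, rfl⟩
    · simp only [lower_lt_lower, lower_lt_upper, upper_lt_upper, true_and] at h'
      rcases h' with ⟨h1, h2⟩ | ⟨h1, h2⟩
      · have : 0 < t := by by_contra! h; nlinarith
        nlinarith
      · have : t < 0 := by by_contra! h; nlinarith
        nlinarith
    · simp at h'

end IsLiftedArc

namespace AnnulusArc

variable {n m : ℕ} {T : Set (AnnulusArc n m)}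

theorem map_shift_mem_preimage {e : Sym2 StripPoint} (h : e ∈ preimage T) (t : ℤ) :
    e.map (shift n m t) ∈ preimage T := by
  obtain ⟨he, heT⟩ := h
  refine ⟨he.map_shift t, ?_⟩
  convert heT using 1
  exact Quotient.sound ⟨-t, map_shift_neg_map_shift t e⟩

theorem isLiftedArc_of_mem {e : Sym2 StripPoint} (h : e ∈ preimage T) : IsLiftedArc n m e := h.1

theorem IsTriangulation.not_crosses (hT : IsTriangulation T) {e f : Sym2 StripPoint}
    (he : e ∈ preimage T) (hf : f ∈ preimage T) : ¬ Crosses e f := by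
  obtain ⟨he, heT⟩ := he
  obtain ⟨hf, hfT⟩ := hf
  by_cases h : (Quotient.mk (deckSetoid n m) ⟨e, he⟩ : AnnulusArc n m) =
      Quotient.mk (deckSetoid n m) ⟨f, hf⟩
  · obtain ⟨t, ht⟩ := Quotient.exact h
    simp only at ht
    rw [← ht]
    exact he.simple t
  · exact hT.prop heT hfT h e ⟨he, rfl⟩ f ⟨hf, rfl⟩

theorem IsTriangulation.mem_preimage (hT : IsTriangulation T) {e : Sym2 StripPoint}
    (he : IsLiftedArc n m e) (h : ∀ f ∈ preimage T, ¬ Crosses e f) : e ∈ preimage T := by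
  refine ⟨he, hT.mem_of_prop_insert ?_⟩
  have key : ∀ β ∈ T, ∀ e' ∈ preimage {Quotient.mk (deckSetoid n m) ⟨e, he⟩},
      ∀ f ∈ preimage {β}, ¬ Crosses e' f := by
    rintro β hβ e' ⟨he', hee'⟩ f ⟨hf, hfβ⟩ hcr
    obtain ⟨t, ht⟩ := Quotient.exact hee'
    simp only at ht
    have hfT : f ∈ preimage T := ⟨hf, by rw [hfβ]; exact hβ⟩
    refine h _ (map_shift_mem_preimage hfT t) ?_
    rw [← ht]
    exact hcr.map_shift t
  refine Set.pairwise_insert.2 ⟨hT.prop, fun β hβ _ => ⟨key β hβ, ?_⟩⟩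
  exact fun f hf e' he' hcr => key β hβ e' he' f hf hcr.symm

theorem IsTriangulation.mk_mem_preimage (hT : IsTriangulation T) {x y : StripPoint} (hxy : x < y)
    (he : IsLiftedArc n m s(x, y))
    (h1 : ∀ c d, s(c, d) ∈ preimage T → x < c → c < y → y < d → False)
    (h2 : ∀ c d, s(c, d) ∈ preimage T → c < x → x < d → d < y → False) :
    s(x, y) ∈ preimage T := by
  refine hT.mem_preimage he fun f hf hcr => ?_
  obtain ⟨c, d, rfl, ⟨h, h', h''⟩ | ⟨h, h', h''⟩⟩ := hcr.exists_eq_mk hxy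
  · exact h1 c d hf h h' h''
  · exact h2 c d hf h h' h''

/-- The points are joined by an arc of the lifted triangulation or by a boundary segment. -/
def Joined (T : Set (AnnulusArc n m)) (p q : StripPoint) : Prop :=
  s(p, q) ∈ preimage T ∨ IsBoundarySegment m s(p, q)

theorem Joined.symm {p q : StripPoint} (h : Joined T p q) : Joined T q p := by
  rwa [Joined, Sym2.eq_swap]

theorem IsTriangulation.not_linked (hT : IsTriangulation T) {a b c d : StripPoint}
    (h : Joined T a b) (h' : Joined T c d) (h1 : a < c) (h2 : c < b) (h3 : b < d) : False := by
  have hcr := crosses_mk h1 h2 h3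
  rcases h with h | h
  · rcases h' with h' | h'
    · exact hT.not_crosses h h' hcr
    · exact h'.not_crosses hcr.symm
  · exact h.not_crosses hcr

theorem joined_succ (k : ℤ) : Joined T (lower k) (lower (k + 1)) := Or.inr (Or.inl ⟨k, rfl⟩)

theorem Joined.sub_le (hn : 0 < n) {p q : ℤ} (h : Joined T (lower p) (lower q)) (hpq : p < q) :
    q - p ≤ n := by
  rcases h with h | h
  · by_contra! hlt
    have hcr : Crosses s(lower p, lower q) s(lower (p + 1 * n), lower (q + 1 * n)) :=
      crosses_mk (by simpa) (by simp; omega) (by simpa)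
    exact (isLiftedArc_of_mem h).simple 1 hcr
  · rw [isBoundarySegment_lower hpq] at h
    omega

theorem IsTriangulation.exists_below (hT : IsTriangulation T) (hn : 0 < n) {p q : ℤ}
    (hpq : p + 1 < q) (h : Joined T (lower p) (lower q)) :
    ∃ x, p < x ∧ x < q ∧ Joined T (lower p) (lower x) ∧ Joined T (lower x) (lower q) := by
  obtain ⟨x, ⟨hpx, hxq, hx⟩, hmax⟩ := Int.exists_greatest_of_bdd
    (P := fun x => p < x ∧ x < q ∧ Joined T (lower p) (lower x))
    ⟨q, fun z hz => hz.2.1.le⟩ ⟨p + 1, by omega, hpq, joined_succ p⟩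
  refine ⟨x, hpx, hxq, hx, ?_⟩
  rcases (show x + 1 ≤ q by omega).eq_or_lt with rfl | hlt
  · exact joined_succ x
  have hle := h.sub_le hn (by omega)
  refine Or.inl (hT.mk_mem_preimage (by simpa) (IsLiftedArc.lower_lower hlt (by omega)) ?_ ?_)
  · intro c d hcd h1 h2 h3
    exact hT.not_linked h (Or.inl hcd) (lt_trans (by simpa) h1) h2 h3
  · intro c d hcd h1 h2 h3
    rcases lt_trichotomy c (lower p) with hc | rfl | hc
    · exact hT.not_linked (Or.inl hcd) h hc (lt_trans (by simpa) h2) h3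
    · obtain ⟨y, rfl, hy⟩ := eq_lower_of_between h2.le h3.le
      simp only [lower_lt_lower] at h2 h3
      have := hmax y ⟨by omega, h3, Or.inl hcd⟩
      omega
    · exact hT.not_linked hx (Or.inl hcd) hc h1 h2

theorem IsTriangulation.exists_above_of_between (hT : IsTriangulation T) (hn : 0 < n)
    {k l p q : ℤ} (hpq : p < q) (h : Joined T (lower p) (lower q)) (hkp : k ≤ p) (hql : q ≤ l)
    (hne : k < p ∨ q < l) (hkl : Joined T (lower k) (lower l)) :
    ∃ x, (x < p ∨ q < x) ∧ Joined T (lower p) (lower x) ∧ Joined T (lower q) (lower x) := by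
  obtain ⟨d, hd⟩ := Int.eq_ofNat_of_zero_le (show 0 ≤ l - k by omega)
  induction d using Nat.strong_induction_on generalizing k l with
  | _ d ih =>
    obtain ⟨x, hkx, hxl, hx, hx'⟩ := hT.exists_below hn (by omega) hkl
    have hxpq : x ≤ p ∨ q ≤ x := by
      by_contra! hcon
      rcases hne with hk | hl
      · exact hT.not_linked hx h (by simpa) (by simpa using hcon.1) (by simpa using hcon.2)
      · exact hT.not_linked h hx' (by simpa using hcon.1) (by simpa using hcon.2) (by simpa)
    rcases hxpq with hxp | hqx
    · by_cases heq : x = p ∧ q = l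
      · obtain ⟨rfl, rfl⟩ := heq
        exact ⟨k, Or.inl hkx, hx.symm, hkl.symm⟩
      · exact ih (l - x).toNat (by omega) hxp hql (by omega) hx' (by omega)
    · by_cases heq : k = p ∧ q = x
      · obtain ⟨rfl, rfl⟩ := heq
        exact ⟨l, Or.inr hxl, hkl, hx'⟩
      · exact ih (x - k).toNat (by omega) hkp hqx (by omega) hx (by omega)

/-- No arc joining lower points passes above the lower point `r`. -/
def Uncovered (T : Set (AnnulusArc n m)) (r : ℤ) : Prop :=
  ∀ w z, w < r → r < z → s(lower w, lower z) ∉ preimage T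

theorem Uncovered.not_mem {r w z : ℤ} (h : Uncovered T r) (hw : w < r) (hz : r < z) :
    s(lower z, lower w) ∉ preimage T := by
  rw [Sym2.eq_swap]
  exact h w z hw hz

theorem exists_shift_gt (hn : 0 < n) (k w : ℤ) : ∃ t : ℤ, w < k + t * n :=
  ⟨|w - k| + 1, by nlinarith [le_abs_self (w - k), abs_nonneg (w - k)]⟩

theorem exists_shift_lt (hn : 0 < n) (k w : ℤ) : ∃ t : ℤ, k + t * n < w :=
  ⟨-(|w - k| + 1), by nlinarith [neg_abs_le (w - k), abs_nonneg (w - k)]⟩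

theorem IsTriangulation.left_mem (hT : IsTriangulation T) (hn : 0 < n) {k r : ℤ}
    (hk : s(left, lower k) ∈ preimage T) (hr : Uncovered T r) :
    s(left, lower r) ∈ preimage T := by
  refine hT.mk_mem_preimage left_lt_lower (IsLiftedArc.left_lower r) ?_ (by simp)
  intro c d hcd h1 h2 h3
  obtain ⟨w, rfl⟩ : ∃ w, c = lower w := by cases c <;> simp_all
  obtain ⟨t, ht⟩ := exists_shift_gt hn k w
  have hk' : s(left, lower (k + t * n)) ∈ preimage T := map_shift_mem_preimage hk t
  have hd : ∀ z, d ≠ lower z := by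
    rintro z rfl
    exact hr w z (by simpa using h2) (by simpa using h3) hcd
  refine hT.not_crosses hk' hcd (crosses_mk h1 (by simpa) ?_)
  cases d <;> simp_all

theorem IsTriangulation.right_mem (hT : IsTriangulation T) (hn : 0 < n) {k r : ℤ}
    (hk : s(lower k, right) ∈ preimage T) (hr : Uncovered T r) :
    s(lower r, right) ∈ preimage T := by
  have key : ∀ z d, s(lower z, d) ∈ preimage T → r < z → d < lower r ∨ right < d → False := by
    intro z d hcd hz hd
    obtain ⟨t, ht⟩ := exists_shift_lt hn k (min z r)
    have hk' : s(lower (k + t * n), right) ∈ preimage T := map_shift_mem_preimage hk t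
    rcases hd with hd | hd
    · cases d with
      | lower w => exact hr.not_mem (by simpa using hd) hz hcd
      | left =>
        rw [Sym2.eq_swap] at hcd
        exact hT.not_crosses hcd hk' (crosses_mk left_lt_lower (by simp; omega) lower_lt_right)
      | right => simp at hd
      | upper u => simp at hd
    · exact hT.not_crosses hk' hcd (crosses_mk (by simp; omega) lower_lt_right hd)
  refine hT.mk_mem_preimage lower_lt_right (IsLiftedArc.lower_right r) ?_ ?_
  · intro c d hcd h1 h2 h3
    obtain ⟨z, rfl⟩ : ∃ z, c = lower z := by cases c <;> simp_all
    exact key z d hcd (by simpa using h1) (Or.inr h3)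
  · intro d c hcd h1 h2 h3
    obtain ⟨z, rfl⟩ : ∃ z, c = lower z := by cases c <;> simp_all
    rw [Sym2.eq_swap] at hcd
    exact key z d hcd (by simpa using h2) (Or.inl h1)

/-- If there are bridging arcs, then two neighbouring uncovered points are joined to a common upper
point. -/
theorem IsTriangulation.exists_upper_mem (hT : IsTriangulation T) (hn : 0 < n) {k v p q : ℤ}
    (hk : s(lower k, upper v) ∈ preimage T) (hpq : p < q) (hj : Joined T (lower p) (lower q))
    (hp : Uncovered T p) (hq : Uncovered T q) :
    ∃ u, s(lower p, upper u) ∈ preimage T ∧ s(lower q, upper u) ∈ preimage T := by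
  have hm : 0 < m := by simpa [IsPresent] using (isLiftedArc_of_mem hk).isPresent (upper v)
  obtain ⟨t₁, ht₁⟩ := exists_shift_lt hn k p
  obtain ⟨t₂, ht₂⟩ := exists_shift_gt hn k p
  have hk₂ : s(lower (k + t₂ * n), upper (v + t₂ * m)) ∈ preimage T :=
    map_shift_mem_preimage hk t₂
  obtain ⟨u, ⟨l, hlp, hl⟩, hmax⟩ := Int.exists_greatest_of_bdd
    (P := fun u => ∃ l ≤ p, s(lower l, upper u) ∈ preimage T)
    ⟨v + t₂ * m, by
      rintro u ⟨l, hlp, hl⟩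
      by_contra! hlt
      exact hT.not_crosses hl hk₂ (crosses_mk (by simp; omega) lower_lt_upper (by simpa))⟩
    ⟨v + t₁ * m, k + t₁ * n, ht₁.le, map_shift_mem_preimage hk t₁⟩
  have no_left : ∀ z d, s(lower z, d) ∈ preimage T → d ≠ left := by
    rintro z _ hz rfl
    rw [Sym2.eq_swap] at hz
    obtain ⟨t, ht⟩ := exists_shift_lt hn k z
    have hk' : s(lower (k + t * n), upper (v + t * m)) ∈ preimage T :=
      map_shift_mem_preimage hk t
    exact hT.not_crosses hz hk' (crosses_mk left_lt_lower (by simpa) lower_lt_upper)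
  have no_right : ∀ z d, s(lower z, d) ∈ preimage T → d ≠ right := by
    rintro z _ hz rfl
    obtain ⟨t, ht⟩ := exists_shift_gt hn k z
    have hk' : s(lower (k + t * n), upper (v + t * m)) ∈ preimage T :=
      map_shift_mem_preimage hk t
    exact hT.not_crosses hz hk' (crosses_mk (by simpa) lower_lt_right right_lt_upper)
  have key : ∀ r, p ≤ r → r ≤ q → Uncovered T r → s(lower r, upper u) ∈ preimage T := by
    intro r hpr hrq hr
    -- an arc that ends strictly between `lower r` and `upper u` does not end outside of them
    have cross : ∀ c d, s(c, d) ∈ preimage T → lower r < c → c < upper u →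
        d < lower r ∨ upper u < d → False := by
      intro c d hcd h1 h2 hd
      cases c with
      | left => simp at h1
      | lower z =>
        cases d with
        | left => exact no_left _ _ hcd rfl
        | right => exact no_right _ _ hcd rfl
        | lower w =>
          exact hr.not_mem (by simpa using hd) (by simpa using h1) hcd
        | upper u' =>
          have hu' : u' < u := by simpa using hd
          have hz : r < z := by simpa using h1
          exact hT.not_crosses hl hcd (crosses_mk (by simp; omega) lower_lt_upper (by simpa))
      | right =>
        cases d with
        | left => exact (isLiftedArc_of_mem hcd).not_meridian Sym2.eq_swap
        | right => exact (isLiftedArc_of_mem hcd).not_contractible rfl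
        | lower w => exact no_right w _ (by rwa [Sym2.eq_swap]) rfl
        | upper u' =>
          have hu' : u' < u := by simpa using hd
          exact hT.not_crosses hl hcd (crosses_mk lower_lt_right right_lt_upper (by simpa))
      | upper u₁ =>
        have hu₁ : u < u₁ := by simpa using h2
        cases d with
        | left =>
          rw [Sym2.eq_swap] at hcd
          exact hT.not_crosses hcd hl (crosses_mk left_lt_lower lower_lt_upper (by simpa))
        | right =>
          simp at hd
        | lower w =>
          have hw : w < r := by simpa using hd
          rw [Sym2.eq_swap] at hcd
          by_cases hwp : w ≤ p
          · have := hmax u₁ ⟨w, hwp, hcd⟩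
            omega
          · exact hT.not_linked hj (Or.inl hcd) (by simpa using hwp)
              (by simp; omega) lower_lt_upper
        | upper u₂ =>
          have hu₂ : u₂ < u := by simpa using hd
          exact hT.not_crosses hl hcd (crosses_mk lower_lt_upper (by simpa) (by simpa))
    refine hT.mk_mem_preimage lower_lt_upper (IsLiftedArc.lower_upper hm r u) ?_ ?_
    · exact fun c d hcd h1 h2 h3 => cross c d hcd h1 h2 (Or.inr h3)
    · intro d c hcd h1 h2 h3
      rw [Sym2.eq_swap] at hcd
      exact cross c d hcd h2 h3 (Or.inl h1)
  exact ⟨u, key p le_rfl hpq.le hp, key q hpq.le le_rfl hq⟩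

theorem IsTriangulation.exists_above_of_uncovered (hT : IsTriangulation T) (hn : 0 < n) {p q : ℤ}
    (hpq : p < q) (hj : Joined T (lower p) (lower q)) (hp : Uncovered T p) (hq : Uncovered T q) :
    ∃ x, (x < lower p ∨ lower q < x) ∧ Joined T (lower p) x ∧ Joined T (lower q) x := by
  by_cases hL : ∃ k, s(left, lower k) ∈ preimage T
  · obtain ⟨k, hk⟩ := hL
    exact ⟨left, Or.inl left_lt_lower, Joined.symm (Or.inl (hT.left_mem hn hk hp)),
      Joined.symm (Or.inl (hT.left_mem hn hk hq))⟩
  by_cases hR : ∃ k, s(lower k, right) ∈ preimage T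
  · obtain ⟨k, hk⟩ := hR
    exact ⟨right, Or.inr lower_lt_right, Or.inl (hT.right_mem hn hk hp),
      Or.inl (hT.right_mem hn hk hq)⟩
  by_cases hB : ∃ k u, s(lower k, upper u) ∈ preimage T
  · obtain ⟨k, u, hk⟩ := hB
    obtain ⟨v, hpv, hqv⟩ := hT.exists_upper_mem hn hk hpq hj hp hq
    exact ⟨upper v, Or.inr lower_lt_upper, Or.inl hpv, Or.inl hqv⟩
  refine absurd ⟨q, ?_⟩ hL
  refine hT.mk_mem_preimage left_lt_lower (IsLiftedArc.left_lower q) ?_ (by simp)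
  intro c d hcd h1 h2 h3
  obtain ⟨w, rfl⟩ : ∃ w, c = lower w := by cases c <;> simp_all
  cases d with
  | left => simp at h3
  | lower z => exact hq w z (by simpa using h2) (by simpa using h3) hcd
  | right => exact hR ⟨w, hcd⟩
  | upper u => exact hB ⟨w, u, hcd⟩

theorem IsTriangulation.exists_above (hT : IsTriangulation T) (hn : 0 < n) {p q : ℤ}
    (hpq : p < q) (hj : Joined T (lower p) (lower q)) :
    ∃ x, (x < lower p ∨ lower q < x) ∧ Joined T (lower p) x ∧ Joined T (lower q) x := by
  by_cases hex : ∃ k l, k ≤ p ∧ q ≤ l ∧ (k < p ∨ q < l) ∧ Joined T (lower k) (lower l)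
  · obtain ⟨k, l, hkp, hql, hne, hkl⟩ := hex
    obtain ⟨x, hx, h⟩ := hT.exists_above_of_between hn hpq hj hkp hql hne hkl
    exact ⟨lower x, by simpa using hx, h⟩
  push Not at hex
  apply hT.exists_above_of_uncovered hn hpq hj
  · intro w z hw hz h
    refine hex w z hw.le ?_ (Or.inl hw) (Or.inl h)
    by_contra! hzq
    exact hT.not_linked (Or.inl h) hj (by simpa) (by simpa) (by simpa)
  · intro w z hw hz h
    refine hex w z ?_ hz.le (Or.inr hz) (Or.inl h)
    by_contra! hwp
    exact hT.not_linked hj (Or.inl h) (by simpa) (by simpa) (by simpa)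

theorem IsTriangle.joined {t : Finset StripPoint} (ht : IsTriangle T t) {x y : StripPoint}
    (hx : x ∈ t) (hy : y ∈ t) (hxy : x ≠ y) : Joined T x y :=
  ht.2 x hx y hy hxy

theorem IsTriangle.exists_eq {t : Finset StripPoint} (ht : IsTriangle T t) {x y : StripPoint}
    (hx : x ∈ t) (hy : y ∈ t) (hxy : x ≠ y) : ∃ z, z ≠ x ∧ z ≠ y ∧ t = {x, y, z} := by
  have hy' : y ∈ t.erase x := Finset.mem_erase.2 ⟨hxy.symm, hy⟩
  have hcard : ((t.erase x).erase y).card = 1 := by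
    rw [Finset.card_erase_of_mem hy', Finset.card_erase_of_mem hx, ht.1]
  obtain ⟨z, hz⟩ := Finset.card_eq_one.1 hcard
  have hz' : z ∈ (t.erase x).erase y := by simp [hz]
  simp only [Finset.mem_erase] at hz'
  exact ⟨z, hz'.2.1, hz'.1, by rw [← hz, Finset.insert_erase hy', Finset.insert_erase hx]⟩

theorem isTriangle_mk {x y z : StripPoint} (hxy : x ≠ y) (hyz : y ≠ z) (hxz : x ≠ z)
    (h1 : Joined T x y) (h2 : Joined T y z) (h3 : Joined T x z) : IsTriangle T {x, y, z} := by
  refine ⟨Finset.card_eq_three.2 ⟨x, y, z, hxy, hxz, hyz, rfl⟩, ?_⟩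
  intro p hp q hq hpq
  simp only [Finset.mem_insert, Finset.mem_singleton] at hp hq
  rcases hp with rfl | rfl | rfl <;> rcases hq with rfl | rfl | rfl <;>
    first | exact absurd rfl hpq | assumption | (apply Joined.symm; assumption)

theorem lower_ne {k l : ℤ} (h : k < l) : lower k ≠ lower l := by
  simp [h.ne]

theorem IsTriangle.joined_lower {t : Finset StripPoint} (ht : IsTriangle T t) {k l : ℤ}
    (hkl : k < l) (hk : lower k ∈ t) (hl : lower l ∈ t) : Joined T (lower k) (lower l) :=
  ht.joined hk hl (lower_ne hkl)

theorem IsTriangle.eq_of_above (hT : IsTriangulation T) {t u : Finset StripPoint}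
    (ht : IsTriangle T t) (hu : IsTriangle T u) {k l : ℤ} (hkl : k < l)
    (htk : lower k ∈ t) (htl : lower l ∈ t) (huk : lower k ∈ u) (hul : lower l ∈ u)
    (htq : ∀ q, k < q → q < l → lower q ∉ t) (huq : ∀ q, k < q → q < l → lower q ∉ u) :
    t = u := by
  have key : ∀ s : Finset StripPoint, IsTriangle T s → lower k ∈ s → lower l ∈ s →
      (∀ q, k < q → q < l → lower q ∉ s) → ∃ x, s = {lower k, lower l, x} ∧
        (x < lower k ∨ lower l < x) ∧ Joined T (lower k) x ∧ Joined T (lower l) x := by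
    intro s hs hk hl hq
    obtain ⟨x, hxk, hxl, heq⟩ := hs.exists_eq hk hl (lower_ne hkl)
    have hx : x ∈ s := by simp [heq]
    refine ⟨x, heq, ?_, hs.joined hk hx hxk.symm, hs.joined hl hx hxl.symm⟩
    by_contra! hcon
    obtain ⟨q, rfl, h1, h2⟩ := eq_lower_of_between hcon.1 hcon.2
    simp only [ne_eq, lower.injEq] at hxk hxl
    exact hq q (by omega) (by omega) hx
  have hlt : lower k < lower l := by simpa
  have step : ∀ x y, (x < lower k ∨ lower l < x) → (y < lower k ∨ lower l < y) → x < y →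
      Joined T (lower k) x → Joined T (lower l) x → Joined T (lower k) y → Joined T (lower l) y →
      False := by
    rintro x y (hx | hx) (hy | hy) hxy hkx hlx hky hly
    · exact hT.not_linked hkx.symm hly.symm hxy hy hlt
    · exact hT.not_linked hlx.symm hky hx hlt hy
    · exact (hlt.trans hx).not_gt (hxy.trans hy)
    · exact hT.not_linked hkx hly hlt hx hxy
  obtain ⟨x, rfl, hx, hkx, hlx⟩ := key t ht htk htl htq
  obtain ⟨y, rfl, hy, hky, hly⟩ := key u hu huk hul huq
  rcases lt_trichotomy x y with h | rfl | h
  · exact (step x y hx hy h hkx hlx hky hly).elim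
  · rfl
  · exact (step y x hy hx h hky hly hkx hlx).elim

theorem IsTriangle.eq_of_three {t : Finset StripPoint} (ht : IsTriangle T t) {k q l : ℤ}
    (hkq : k < q) (hql : q < l) (hk : lower k ∈ t) (hq : lower q ∈ t) (hl : lower l ∈ t) :
    t = {lower k, lower q, lower l} := by
  symm
  apply Finset.eq_of_subset_of_card_le
  · simp [Finset.insert_subset_iff, hk, hq, hl]
  · rw [ht.1, Finset.card_eq_three.2 ⟨_, _, _, lower_ne hkq, lower_ne (hkq.trans hql),
      lower_ne hql, rfl⟩]

theorem IsTriangle.eq_of_below (hT : IsTriangulation T) {t u : Finset StripPoint}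
    (ht : IsTriangle T t) (hu : IsTriangle T u) {k l q r : ℤ} (hkq : k < q) (hql : q < l)
    (hkr : k < r) (hrl : r < l) (htk : lower k ∈ t) (htq : lower q ∈ t) (htl : lower l ∈ t)
    (huk : lower k ∈ u) (hur : lower r ∈ u) (hul : lower l ∈ u) : t = u := by
  rw [ht.eq_of_three hkq hql htk htq htl, hu.eq_of_three hkr hrl huk hur hul]
  rcases lt_trichotomy q r with h | rfl | h
  · exact (hT.not_linked (hu.joined_lower hkr huk hur) (ht.joined_lower hql htq htl) (by simpa)
      (by simpa) (by simpa)).elim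
  · rfl
  · exact (hT.not_linked (ht.joined_lower hkq htk htq) (hu.joined_lower hrl hur hul) (by simpa)
      (by simpa) (by simpa)).elim

theorem IsTriangle.confined (hT : IsTriangulation T) {u : Finset StripPoint}
    (hu : IsTriangle T u) {k l q : ℤ} (hkl : Joined T (lower k) (lower l)) (hkq : k < q)
    (hql : q < l) (hq : lower q ∈ u) :
    ∃ p x r, k ≤ p ∧ p < x ∧ x < r ∧ r ≤ l ∧ lower p ∈ u ∧ lower x ∈ u ∧ lower r ∈ u := by
  have key : ∀ x ∈ u, x ≠ lower q → ∃ a, x = lower a ∧ k ≤ a ∧ a ≤ l := by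
    intro x hx hxq
    apply eq_lower_of_between
    · by_contra! hlt
      exact hT.not_linked (hu.joined hx hq hxq) hkl hlt (by simpa) (by simpa)
    · by_contra! hlt
      exact hT.not_linked hkl (hu.joined hq hx hxq.symm) (by simpa) (by simpa) hlt
  obtain ⟨y, hy, hyq⟩ := Finset.exists_mem_ne (s := u) (by rw [hu.1]; norm_num) (lower q)
  obtain ⟨z, hzy, hzq, heq⟩ := hu.exists_eq hy hq hyq
  have hz : z ∈ u := by simp [heq]
  obtain ⟨a, rfl, hka, hal⟩ := key y hy hyq
  obtain ⟨b, rfl, hkb, hbl⟩ := key z hz hzq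
  simp only [ne_eq, lower.injEq] at hyq hzy hzq
  rcases lt_or_gt_of_ne hyq with h1 | h1 <;> rcases lt_or_gt_of_ne hzy with h2 | h2 <;>
    rcases lt_or_gt_of_ne hzq with h3 | h3
  · exact ⟨b, a, q, hkb, h2, h1, hql.le, hz, hy, hq⟩
  · omega
  · exact ⟨a, b, q, hka, h2, h3, hql.le, hy, hz, hq⟩
  · exact ⟨a, q, b, hka, h1, h3, hbl, hy, hq, hz⟩
  · exact ⟨b, q, a, hkb, h3, h1, hal, hz, hq, hy⟩
  · exact ⟨q, b, a, hkq.le, h3, h2, hal, hq, hz, hy⟩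
  · omega
  · exact ⟨q, a, b, hkq.le, h1, h2, hbl, hq, hy, hz⟩

/-- The triangles at the lower marked points, provided that there are finitely many at each. -/
noncomputable def fanSystem (hT : IsTriangulation T) (hn : 0 < n)
    (hfin : ∀ k, {t | IsTriangle T t ∧ lower k ∈ t}.Finite) : FanSystem (Finset StripPoint) where
  fan k := (hfin k).toFinset
  exists_consecutive k := by
    obtain ⟨x, hx, h1, h2⟩ := hT.exists_above hn (show k < k + 1 by omega) (joined_succ k)
    have hlt : lower k < lower (k + 1) := by simp
    have hxk : lower k ≠ x := by
      rintro rfl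
      exact hx.elim (lt_irrefl _) hlt.not_gt
    have hxl : lower (k + 1) ≠ x := by
      rintro rfl
      exact hx.elim hlt.not_gt (lt_irrefl _)
    have ht := isTriangle_mk hlt.ne hxl hxk (joined_succ k) h2 h1
    exact ⟨{lower k, lower (k + 1), x}, by simp [ht], by simp [ht]⟩
  noncrossing := by
    intro p q r s t u hpq hqr hrs htp htr huq hus
    simp only [Set.Finite.mem_toFinset, Set.mem_ofPred_eq] at *
    exact hT.not_linked (htp.1.joined_lower (hpq.trans hqr) htp.2 htr.2)
      (huq.1.joined_lower (hqr.trans hrs) huq.2 hus.2) (by simpa) (by simpa) (by simpa)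
  exists_above := by
    intro k l t hkl htk htl
    simp only [Set.Finite.mem_toFinset, Set.mem_ofPred_eq] at *
    have hj := htk.1.joined_lower hkl htk.2 htl.2
    obtain ⟨x, hx, h1, h2⟩ := hT.exists_above hn hkl hj
    have hlt : lower k < lower l := by simpa
    have hxk : lower k ≠ x := by
      rintro rfl
      exact hx.elim (lt_irrefl _) hlt.not_gt
    have hxl : lower l ≠ x := by
      rintro rfl
      exact hx.elim hlt.not_gt (lt_irrefl _)
    have ht := isTriangle_mk hlt.ne hxl hxk hj h2 h1
    refine ⟨{lower k, lower l, x}, by simp [ht], by simp [ht], ?_⟩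
    rintro q hkq hql ⟨-, hq⟩
    simp only [Finset.mem_insert, lower.injEq, Finset.mem_singleton] at hq
    rcases hq with rfl | rfl | rfl
    · exact lt_irrefl _ hkq
    · exact lt_irrefl _ hql
    · simp only [lower_lt_lower] at hx
      omega
  above_unique := by
    intro k l t u hkl htk htl huk hul ht hu
    simp only [Set.Finite.mem_toFinset, Set.mem_ofPred_eq, not_and] at *
    exact htk.1.eq_of_above hT huk.1 hkl htk.2 htl.2 huk.2 hul.2
      (fun q h1 h2 => ht q h1 h2 htk.1) (fun q h1 h2 => hu q h1 h2 huk.1)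
  exists_below := by
    intro k l t hkl htk htl
    simp only [Set.Finite.mem_toFinset, Set.mem_ofPred_eq] at *
    have hj := htk.1.joined_lower (by omega) htk.2 htl.2
    obtain ⟨x, hkx, hxl, h1, h2⟩ := hT.exists_below hn hkl hj
    have ht := isTriangle_mk (lower_ne hkx) (lower_ne hxl) (lower_ne (hkx.trans hxl)) h1 h2 hj
    exact ⟨{lower k, lower x, lower l}, x, hkx, hxl, by simp [ht], by simp [ht], by simp [ht]⟩
  below_unique := by
    intro k l q r t u hkq hql hkr hrl htk htq htl huk hur hul
    simp only [Set.Finite.mem_toFinset, Set.mem_ofPred_eq] at *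
    exact htk.1.eq_of_below hT huk.1 hkq hql hkr hrl htk.2 htq.2 htl.2 huk.2 hur.2 hul.2
  confined := by
    intro k l q t u hkq hql htk htl huq
    simp only [Set.Finite.mem_toFinset, Set.mem_ofPred_eq] at *
    obtain ⟨p, x, r, h1, h2, h3, h4, h5, h6, h7⟩ :=
      huq.1.confined hT (htk.1.joined_lower (hkq.trans hql) htk.2 htl.2) hkq hql huq.2
    exact ⟨p, x, r, h1, h2, h3, h4, ⟨huq.1, h5⟩, ⟨huq.1, h6⟩, ⟨huq.1, h7⟩⟩

theorem mem_fanSystem_fan {hT : IsTriangulation T} {hn : 0 < n}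
    {hfin : ∀ k, {t | IsTriangle T t ∧ lower k ∈ t}.Finite} {k : ℤ} {t : Finset StripPoint} :
    t ∈ (fanSystem hT hn hfin).fan k ↔ IsTriangle T t ∧ lower k ∈ t := by
  simp [fanSystem]

theorem card_fanSystem_fan (hT : IsTriangulation T) (hn : 0 < n)
    (hfin : ∀ k, {t | IsTriangle T t ∧ lower k ∈ t}.Finite) (k : ℤ) :
    ((fanSystem hT hn hfin).fan k).card = quiddity T k :=
  (Set.ncard_eq_toFinset_card _ (hfin k)).symm

theorem Joined.shift {p q : StripPoint} (h : Joined T p q) (t : ℤ) :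
    Joined T (p.shift n m t) (q.shift n m t) := by
  rcases h with h | h
  · exact Or.inl (map_shift_mem_preimage h t)
  · exact Or.inr (h.map_shift (n := n) t)

theorem IsTriangle.image_shift {t : Finset StripPoint} (ht : IsTriangle T t) (s : ℤ) :
    IsTriangle T (t.image (shift n m s)) := by
  refine ⟨by rw [Finset.card_image_of_injective _ (shift_strictMono s).injective, ht.1], ?_⟩
  intro p hp q hq hpq
  obtain ⟨x, hx, rfl⟩ := Finset.mem_image.1 hp
  obtain ⟨y, hy, rfl⟩ := Finset.mem_image.1 hq
  exact (ht.joined hx hy fun h => hpq (h ▸ rfl)).shift s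

theorem image_shift_triangles (k s : ℤ) :
    Finset.image (shift n m s) '' {t | IsTriangle T t ∧ lower k ∈ t} =
      {t | IsTriangle T t ∧ lower (k + s * n) ∈ t} := by
  apply Set.Subset.antisymm
  · rintro _ ⟨t, ⟨ht, hk⟩, rfl⟩
    exact ⟨ht.image_shift s, Finset.mem_image_of_mem (shift n m s) hk⟩
  · rintro t ⟨ht, hk⟩
    refine ⟨t.image (shift n m (-s)), ⟨ht.image_shift (-s), ?_⟩, ?_⟩
    · have := Finset.mem_image_of_mem (shift n m (-s)) hk
      simpa [shift] using this
    · rw [Finset.image_image, shift_comp, neg_add_cancel, shift_zero, Finset.image_id]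

theorem quiddity_add_mul (k s : ℤ) : quiddity T (k + s * n) = quiddity T k := by
  rw [quiddity, ← image_shift_triangles, Set.ncard_image_of_injective, quiddity]
  exact Finset.image_injective (shift_strictMono s).injective

theorem Realizes.quiddity_eq {F : InfiniteFrieze} (hTF : Realizes T F) (hF : F.HasPeriod n)
    (hn : 0 < n) (k : ℤ) : (quiddity T k : ℤ) = F.quiddity k := by
  have hper : Function.Periodic F.quiddity (n : ℤ) := hF
  have hn' : (0 : ℤ) < n := by exact_mod_cast hn
  have h0 := Int.emod_nonneg (k - 1) hn'.ne'
  have h1 := Int.emod_lt_of_pos (k - 1) hn'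
  have h2 := Int.emod_add_mul_ediv (k - 1) n
  have hk : k = (k - 1) % n + 1 + (k - 1) / n * n := by linarith
  have h3 := hper.int_mul ((k - 1) / n) ((k - 1) % n + 1)
  rw [Int.cast_id] at h3
  rw [hk, quiddity_add_mul, h3]
  exact hTF _ (by omega) (by omega)

theorem matchings_eq_image (hT : IsTriangulation T) (hn : 0 < n)
    (hfin : ∀ k, {t | IsTriangle T t ∧ lower k ∈ t}.Finite) (i j : ℤ) :
    matchings T i j = (fun f (k : Finset.Icc i j) => f k) ''
      (fanSystem hT hn hfin).matchings i (j + 1) := by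
  ext f
  constructor
  · rintro ⟨hinj, hf⟩
    refine ⟨fun k => if h : k ∈ Finset.Icc i j then f ⟨k, h⟩ else (fanSystem hT hn hfin).mid k,
      ⟨?_, ?_, ?_⟩, ?_⟩
    · intro k hk l hl hkl
      have hk' : k ∈ Finset.Icc i j := by simp at hk ⊢; omega
      have hl' : l ∈ Finset.Icc i j := by simp at hl ⊢; omega
      simp only [hk', hl', dif_pos] at hkl
      simpa using hinj hkl
    · intro k hk
      have hk' : k ∈ Finset.Icc i j := by simp at hk ⊢; omega
      simp only [hk', dif_pos]
      exact mem_fanSystem_fan.2 (hf ⟨k, hk'⟩)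
    · intro k hk
      have hk' : k ∉ Finset.Icc i j := by simp at hk ⊢; omega
      simp only [hk', dif_neg, not_false_eq_true]
    · funext k
      simp only [k.2, dif_pos]
  · rintro ⟨f, ⟨hinj, hf, -⟩, rfl⟩
    have hmem : ∀ k : Finset.Icc i j, (k : ℤ) ∈ Set.Ico i (j + 1) := by
      rintro ⟨k, hk⟩
      simp at hk ⊢
      omega
    exact ⟨fun k l hkl => Subtype.ext (hinj (hmem k) (hmem l) hkl),
      fun k => mem_fanSystem_fan.1 (hf k (hmem k))⟩

theorem injOn_restrict_matchings (A : FanSystem (Finset StripPoint)) (i j : ℤ) :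
    Set.InjOn (fun (f : ℤ → Finset StripPoint) (k : Finset.Icc i j) => f k)
      (A.matchings i (j + 1)) := by
  intro f hf g hg hfg
  funext k
  by_cases hk : k ∈ Set.Ico i (j + 1)
  · exact congrFun hfg ⟨k, by simp at hk ⊢; omega⟩
  · rw [hf.2.2 k hk, hg.2.2 k hk]

end AnnulusArc

theorem corollary5p8 (n m : ℕ) (hn : 0 < n) (F : InfiniteFrieze) (hF : F.HasPeriod n)
    (T : Set (AnnulusArc n m)) (hT : AnnulusArc.IsTriangulation T)
    (hTF : AnnulusArc.Realizes T F) :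
    ∀ i j : ℤ, i ≤ j →
      (AnnulusArc.matchings T i j).Finite ∧
        ((AnnulusArc.matchings T i j).ncard : ℤ) = F.entry i j := by
  intro i j hij
  have hq : ∀ k, (AnnulusArc.quiddity T k : ℤ) = F.quiddity k := hTF.quiddity_eq hF hn
  have hfin : ∀ k, {t | AnnulusArc.IsTriangle T t ∧ StripPoint.lower k ∈ t}.Finite := by
    intro k
    apply Set.finite_of_ncard_pos
    have := F.entry_pos k k le_rfl
    rw [← InfiniteFrieze.quiddity, ← hq] at this
    exact_mod_cast this
  rw [AnnulusArc.matchings_eq_image hT hn hfin]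
  refine ⟨(FanSystem.finite_matchings _ _).image _, ?_⟩
  rw [(AnnulusArc.injOn_restrict_matchings _ i j).ncard_image]
  exact (FanSystem.ncard_matchings_eq_entry F
    (fun k => by rw [AnnulusArc.card_fanSystem_fan, hq]) hij).2
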